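/- Let $\nu$ be a finite positive Borel measure on $[0,2\pi)$, identified with the unit circle $\mathbb T$ via $\theta\mapsto e^{i\theta}$, and let $\mathbf H_2(d\nu)$ be the closed linear span in $\mathbf L_2(d\nu)$ of the functions $z^m$, $m\ge 0$ (with $z=e^{i\theta}$). Assume that $\mathbf H_2(d\nu)\neq\mathbf L_2(d\nu)$. Then $\mathbf H_2(d\nu)$ has a reproducing kernel on the open unit disc $\mathbb D$, in the following sense: for every $w\in\mathbb D$ the point evaluation $p\mapsto p(w)$ on polynomials extends to a bounded linear functional on $\mathbf H_2(d\nu)$, that is, there is $k_w\in\mathbf H_2(d\nu)$ with \[ \langle p,k_w\rangle_{\mathbf L_2(d\nu)}=p(w)\qquad\text{for all polynomials } p . \] Moreover there are functions $A$ and $B$, analytic in $\mathbb C\setminus\mathbb T$, such that the reproducing kernel $K(z,w)=\langle k_w,k_z\rangle_{\mathbf L_2(d\nu)}$ is \[ K(z,w)=\frac{A(z)A(w)^*-B(z)B(w)^*}{1-zw^*},\qquad z,w\in\mathbb D . \] If moreover $\nu$ is absolutely continuous with respect to Lebesgue measure $d\theta$, then an element $f\in\mathbf H_2(d\nu)$ is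 determined by its values $f(w)=\langle f,k_w\rangle$, $w\in\mathbb D$. In that case $\mathbf H_2(d\nu)$ is a reproducing kernel Hilbert space of functions on $\mathbb D$, in which every polynomial is represented by itself, and its reproducing kernel is $K$. -/

import Mathlib

open MeasureTheory ComplexConjugate

noncomputable section

instance factTwoPiPos : Fact (0 < 2 * Real.pi) := ⟨Real.two_pi_pos⟩

/-- The space `L²(dν)` of a measure `ν` on `[0, 2π)`, that is, on the circle `ℝ / 2πℤ`. -/
abbrev LTwo (ν : Measure (AddCircle (2 * Real.pi))) : Type := Lp ℂ 2 ν

/-- The function `θ ↦ p(e^{iθ})` on the circle, for a polynomial `p`. -/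
def polyOnCircle (p : Polynomial ℂ) : C(AddCircle (2 * Real.pi), ℂ) where
  toFun θ := p.eval (fourier 1 θ)
  continuous_toFun := p.continuous.comp (fourier 1).continuous

/-- The class in `L²(dν)` of the boundary function `θ ↦ p(e^{iθ})` of a polynomial `p`. -/
def polyLTwo (ν : Measure (AddCircle (2 * Real.pi))) [IsFiniteMeasure ν] (p : Polynomial ℂ) :
    LTwo ν :=
  ContinuousMap.toLp (E := ℂ) 2 ν ℂ (polyOnCircle p)

/-- The space `H₂(dν)`: the closed linear span in `L²(dν)` of the functions `z ^ m`, `m ≥ 0`. -/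
def HTwo (ν : Measure (AddCircle (2 * Real.pi))) [IsFiniteMeasure ν] : Submodule ℂ (LTwo ν) :=
  (Submodule.span ℂ (Set.range fun m : ℕ => polyLTwo ν (Polynomial.X ^ m))).topologicalClosure

instance HTwo.instCompleteSpace (ν : Measure (AddCircle (2 * Real.pi))) [IsFiniteMeasure ν] :
    CompleteSpace (HTwo ν) :=
  (Submodule.isClosed_topologicalClosure _).completeSpace_coe

theorem polyLTwo_mem_HTwo (ν : Measure (AddCircle (2 * Real.pi))) [IsFiniteMeasure ν]
    (p : Polynomial ℂ) : polyLTwo ν p ∈ HTwo ν := by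
  apply Submodule.le_topologicalClosure
  induction p using Polynomial.induction_on' with
  | add p q hp hq =>
    have h : polyLTwo ν (p + q) = polyLTwo ν p + polyLTwo ν q := by
      have h0 : polyOnCircle (p + q) = polyOnCircle p + polyOnCircle q := by
        ext θ; simp [polyOnCircle]
      rw [polyLTwo, h0, map_add]; rfl
    rw [h]
    exact Submodule.add_mem _ hp hq
  | monomial n a =>
    have h : polyLTwo ν (Polynomial.monomial n a) = a • polyLTwo ν (Polynomial.X ^ n) := by
      have h0 : polyOnCircle (Polynomial.monomial n a) = a • polyOnCircle (Polynomial.X ^ n) := by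
        ext θ; simp [polyOnCircle]
      rw [polyLTwo, h0, map_smul]; rfl
    rw [h]
    exact Submodule.smul_mem _ _ (Submodule.subset_span ⟨n, rfl⟩)

/-- A polynomial, viewed as an element of `H₂(dν)`. -/
def polyHTwo (ν : Measure (AddCircle (2 * Real.pi))) [IsFiniteMeasure ν] (p : Polynomial ℂ) :
    HTwo ν :=
  ⟨polyLTwo ν p, polyLTwo_mem_HTwo ν p⟩

/-- `k` is the family of reproducing vectors `k_w`, `|w| < 1`, of `H₂(dν)`: for every `w` the
evaluation `p ↦ p(w)` of polynomials extends to the bounded functional `f ↦ ⟨f, k_w⟩` on `H₂(dν)`.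
(Mathlib's inner product is conjugate-linear in its first entry.) -/
def IsReproducingFamily (ν : Measure (AddCircle (2 * Real.pi))) [IsFiniteMeasure ν]
    (k : Metric.ball (0 : ℂ) 1 → HTwo ν) : Prop :=
  ∀ (w : Metric.ball (0 : ℂ) 1) (p : Polynomial ℂ), inner ℂ (k w) (polyHTwo ν p) = p.eval (w : ℂ)

/-- The kernel `(A(z) A(w)* - B(z) B(w)*) / (1 - z w*)`. -/
def differenceKernel (A B : ℂ → ℂ) (z w : ℂ) : ℂ :=
  (A z * conj (A w) - B z * conj (B w)) / (1 - z * conj w)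

end

/-! Multiplication by `z` is an isometry `S` of `H₂(dν)`. Were it onto, `H₂(dν)` would contain every
`e^{inθ}` and equal `L²(dν)`; so there is a unit vector `e` orthogonal to the range of `S`. The
vectors `c_w = (1 - w* S)⁻¹ e` satisfy `⟪c_w, S x⟫ = w ⟪c_w, x⟫`, hence `⟪c_w, p⟫ = p(w) ⟪c_w, 1⟫`.
The factor `⟪c_w, 1⟫` is nonzero and analytic in `w`, so rescaling `c_w` gives `k_w`. The Gram
kernel of the `c_w` is `1 / (1 - z w*)`; therefore `A(w) = 1 / ⟪c_w, 1⟫` in the disc and `B = 0`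
suffice.

For `ν ≪ dθ`, the measure `|e|² dν` has the Fourier coefficients of normalised Lebesgue measure and
equals it, so `e ≠ 0` almost everywhere. If `f` is orthogonal to all `k_w`, it is orthogonal to `zⁿ
e` for all integers `n`: for `n ≥ 0` by the resolvent recursion, for `n < 0` because `e ⊥ z H₂(dν)`.
Then `f / e` has zero Fourier coefficients, and `f = 0`. -/

noncomputable section

/-! ### Resolvent vectors of a Hilbert space contraction or isometry. -/

section CauchyVector

variable {E : Type*} [NormedAddCommGroup E] [InnerProductSpace ℂ E] [CompleteSpace E]

theorem isUnit_one_sub_smul {T : E →L[ℂ] E} (hT : ‖T‖ ≤ 1) {w : ℂ} (hw : ‖w‖ < 1) :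
    IsUnit (1 - w • T) := by
  apply isUnit_one_sub_of_norm_lt_one
  rw [norm_smul]
  exact (mul_le_of_le_one_right (norm_nonneg w) hT).trans_lt hw

/-- `w ↦ (1 - w T)⁻¹ x` is analytic in the unit disc, for a contraction `T`. -/
theorem analyticAt_inverse_one_sub_smul {T : E →L[ℂ] E} (hT : ‖T‖ ≤ 1) (x : E) {w : ℂ}
    (hw : ‖w‖ < 1) : AnalyticAt ℂ (fun z : ℂ => Ring.inverse (1 - z • T) x) w := by
  obtain ⟨u, hu⟩ := isUnit_one_sub_smul hT hw
  have h1 : AnalyticAt ℂ (fun z : ℂ => 1 - z • T) w :=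
    analyticAt_const.sub (analyticAt_id.smul analyticAt_const)
  have h2 : AnalyticAt ℂ (Ring.inverse : (E →L[ℂ] E) → (E →L[ℂ] E)) (1 - w • T) := by
    rw [← hu]; exact analyticAt_inverse u
  have h3 : AnalyticAt ℂ (fun z : ℂ => Ring.inverse (1 - z • T)) w := AnalyticAt.fun_comp h2 h1
  exact ((ContinuousLinearMap.apply ℂ E x).analyticAt _).comp h3

/-- The vector `(1 - w* T)⁻¹ e`; for the shift `T` it is the function `e / (1 - w* z)`. -/
def cauchyVector (T : E →L[ℂ] E) (e : E) (w : ℂ) : E := Ring.inverse (1 - conj w • T) e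

variable {T : E →L[ℂ] E} {e : E} {w : ℂ}

theorem cauchyVector_eq (hT : ‖T‖ ≤ 1) (hw : ‖w‖ < 1) :
    cauchyVector T e w = e + conj w • T (cauchyVector T e w) := by
  have hu : IsUnit (1 - conj w • T) := isUnit_one_sub_smul hT (by simpa using hw)
  have h := congrArg (fun S : E →L[ℂ] E => S e) (Ring.mul_inverse_cancel _ hu)
  rw [← sub_eq_iff_eq_add]
  simpa [cauchyVector] using h

/-- Passing to the adjoint removes the conjugate on `w`, which makes the pairing visibly analytic.
-/
theorem inner_cauchyVector (hT : ‖T‖ ≤ 1) (hw : ‖w‖ < 1) (x : E) :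
    inner ℂ (cauchyVector T e w) x =
      inner ℂ e (Ring.inverse (1 - w • ContinuousLinearMap.adjoint T) x) := by
  have hu : IsUnit (1 - w • ContinuousLinearMap.adjoint T) :=
    isUnit_one_sub_smul (by simpa using hT) hw
  have h := congrArg (fun S : E →L[ℂ] E => S x) (Ring.mul_inverse_cancel _ hu)
  set y := Ring.inverse (1 - w • ContinuousLinearMap.adjoint T) x
  have hx : y - w • ContinuousLinearMap.adjoint T y = x := by simpa using h
  have he : cauchyVector T e w - conj w • T (cauchyVector T e w) = e :=
    sub_eq_iff_eq_add.2 (cauchyVector_eq hT hw)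
  rw [← hx]
  conv_rhs => rw [← he]
  simp [inner_sub_left, inner_sub_right, inner_smul_left, inner_smul_right,
    ContinuousLinearMap.adjoint_inner_right, mul_comm]

theorem analyticAt_inner_cauchyVector (hT : ‖T‖ ≤ 1) (x : E) (hw : ‖w‖ < 1) :
    AnalyticAt ℂ (fun z => inner ℂ (cauchyVector T e z) x) w := by
  have h1 : AnalyticAt ℂ (fun z : ℂ =>
      inner ℂ e (Ring.inverse (1 - z • ContinuousLinearMap.adjoint T) x)) w :=
    ((innerSL ℂ e).analyticAt _).comp
      (analyticAt_inverse_one_sub_smul (by simpa using hT) x hw)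
  refine h1.congr ?_
  have hball : Metric.ball (0 : ℂ) 1 ∈ nhds w := Metric.isOpen_ball.mem_nhds (by simpa using hw)
  filter_upwards [hball] with z hz
  exact (inner_cauchyVector hT (by simpa using hz) x).symm

omit [CompleteSpace E] in
theorem cauchyVector_zero : cauchyVector T e 0 = e := by simp [cauchyVector]

theorem cauchyVector_ne_zero (hT : ‖T‖ ≤ 1) (hw : ‖w‖ < 1) (he : e ≠ 0) :
    cauchyVector T e w ≠ 0 := by
  intro h
  have := cauchyVector_eq (e := e) hT hw
  rw [h] at this
  exact he (by simpa using this.symm)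

omit [CompleteSpace E] in
theorem opNorm_le_one_of_inner_map_map (hT : ∀ x y, inner ℂ (T x) (T y) = inner ℂ x y) :
    ‖T‖ ≤ 1 := by
  refine T.opNorm_le_bound zero_le_one fun x => ?_
  rw [one_mul, ← abs_norm, ← abs_norm x, ← sq_le_sq, ← inner_self_eq_norm_sq (𝕜 := ℂ), hT,
    inner_self_eq_norm_sq]

/-- In `c_w = e + w* T c_w` the first term is orthogonal to `T x`, and the isometry cancels `T` in
the second. -/
theorem inner_cauchyVector_map (hT : ∀ x y, inner ℂ (T x) (T y) = inner ℂ x y)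
    (heT : ∀ x, inner ℂ e (T x) = 0) (hw : ‖w‖ < 1) (x : E) :
    inner ℂ (cauchyVector T e w) (T x) = w * inner ℂ (cauchyVector T e w) x := by
  conv_lhs => rw [cauchyVector_eq (opNorm_le_one_of_inner_map_map hT) hw]
  simp [inner_add_left, inner_smul_left, heT, hT, mul_comm]

theorem inner_cauchyVector_cauchyVector (hT : ∀ x y, inner ℂ (T x) (T y) = inner ℂ x y)
    (heT : ∀ x, inner ℂ e (T x) = 0) (he : ‖e‖ = 1) {z : ℂ} (hz : ‖z‖ < 1) (hw : ‖w‖ < 1) :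
    inner ℂ (cauchyVector T e z) (cauchyVector T e w) = 1 / (1 - z * conj w) := by
  have hT1 := opNorm_le_one_of_inner_map_map hT
  have h1 : inner ℂ (cauchyVector T e z) e = 1 := by
    rw [cauchyVector_eq hT1 hz, inner_add_left, inner_smul_left, ← inner_conj_symm (T _) e, heT,
      inner_self_eq_norm_sq_to_K, he]
    simp
  have h2 : inner ℂ (cauchyVector T e z) (cauchyVector T e w) =
      1 + conj w * (z * inner ℂ (cauchyVector T e z) (cauchyVector T e w)) := by
    conv_lhs => rw [cauchyVector_eq hT1 hw, inner_add_right, h1, inner_smul_right,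
      inner_cauchyVector_map hT heT hz]
  have h3 : 1 - z * conj w ≠ 0 := by
    intro h
    have h4 : ‖z‖ * ‖w‖ = 1 := by
      have := congrArg norm (sub_eq_zero.1 h)
      simpa using this.symm
    nlinarith [norm_nonneg z, norm_nonneg w]
  rw [eq_div_iff h3]
  linear_combination h2

/-- A vector orthogonal to all `(1 - w* T)⁻¹ e` is orthogonal to all `Tⁿ e`. -/
theorem inner_pow_eq_zero_of_inner_cauchyVector_eq_zero (hT : ‖T‖ ≤ 1) (n : ℕ) :
    ∀ x : E, (∀ w : ℂ, ‖w‖ < 1 → inner ℂ (cauchyVector T e w) x = 0) →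
      inner ℂ ((T ^ n) e) x = 0 := by
  induction n with
  | zero =>
    intro x hx
    simpa [cauchyVector_zero] using hx 0 (by simp)
  | succ n ih =>
    intro x hx
    have he : inner ℂ e x = 0 := by simpa [cauchyVector_zero] using hx 0 (by simp)
    -- As `e ⊥ x`, the recursion gives `w ⟪c_w, T* x⟫ = 0`, so `T* x` inherits the hypothesis for `w
    -- ≠ 0`; continuity supplies `w = 0`.
    have key : inner ℂ ((T ^ n) e) (ContinuousLinearMap.adjoint T x) = 0 := by
      apply ih
      have hne : ∀ w : ℂ, ‖w‖ < 1 → w ≠ 0 →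
          inner ℂ (cauchyVector T e w) (ContinuousLinearMap.adjoint T x) = 0 := by
        intro w hw hw0
        have h := hx w hw
        rw [cauchyVector_eq hT hw, inner_add_left, he, inner_smul_left, zero_add] at h
        rw [ContinuousLinearMap.adjoint_inner_right]
        simpa [hw0] using h
      intro w hw
      by_cases hw0 : w = 0
      · subst hw0
        have hc := (analyticAt_inner_cauchyVector (e := e) hT
          (ContinuousLinearMap.adjoint T x) hw).continuousAt
        refine tendsto_nhds_unique (hc.tendsto.mono_left (nhdsWithin_le_nhds (s := {0}ᶜ))) ?_
        refine tendsto_const_nhds.congr' ?_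
        have hball : Metric.ball (0 : ℂ) 1 ∈ nhdsWithin (0 : ℂ) {0}ᶜ :=
          mem_nhdsWithin_of_mem_nhds (Metric.ball_mem_nhds _ one_pos)
        filter_upwards [hball, self_mem_nhdsWithin] with z hz hz0
        exact (hne z (by simpa using hz) hz0).symm
      · exact hne w hw hw0
    rw [ContinuousLinearMap.adjoint_inner_right] at key
    rw [pow_succ']
    exact key

/-- The range of a non-surjective linear isometry of a Hilbert space has a unit normal vector. -/
theorem exists_unit_vector_orthogonal_range (hT : ∀ x y, inner ℂ (T x) (T y) = inner ℂ x y)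
    (hsurj : ¬ Function.Surjective T) : ∃ e : E, ‖e‖ = 1 ∧ ∀ x, inner ℂ e (T x) = 0 := by
  have hiso : Isometry T := (T.toLinearMap.isometryOfInner hT).isometry
  have hclosed : IsClosed (T.range : Set E) := hiso.isClosedEmbedding.isClosed_range
  have : CompleteSpace T.range := hclosed.completeSpace_coe
  have hne : T.rangeᗮ ≠ ⊥ := by
    rw [Ne, Submodule.orthogonal_eq_bot_iff, LinearMap.range_eq_top]
    exact hsurj
  obtain ⟨x, hx, hx0⟩ := Submodule.exists_mem_ne_zero_of_ne_bot hne
  refine ⟨(‖x‖⁻¹ : ℂ) • x, norm_smul_inv_norm hx0, fun y => ?_⟩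
  have hxy : inner ℂ x (T y) = 0 := (Submodule.mem_orthogonal' _ _).1 hx _ ⟨y, rfl⟩
  rw [inner_smul_left, hxy, mul_zero]

end CauchyVector

/-! ### Multiplication by `e^{inθ}` and the shift on `H₂(dν)`. -/

section FourierMul

variable (ν : Measure (AddCircle (2 * Real.pi))) [IsFiniteMeasure ν]

/-- Multiplication by `e^{inθ}` on `L²(dν)`. -/
def fourierMul (n : ℤ) : LTwo ν →L[ℂ] LTwo ν :=
  (ContinuousLinearMap.mul ℂ ℂ).holderL ν ⊤ 2 2 (ContinuousMap.toLp (E := ℂ) ⊤ ν ℂ (fourier n))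

theorem coeFn_fourierMul (n : ℤ) (f : LTwo ν) :
    fourierMul ν n f =ᵐ[ν] fun θ => fourier n θ * f θ := by
  have h1 := (ContinuousLinearMap.mul ℂ ℂ).coeFn_holder (μ := ν) (r := 2)
    (ContinuousMap.toLp (E := ℂ) ⊤ ν ℂ (fourier n)) f
  have h2 := ContinuousMap.coeFn_toLp (E := ℂ) (p := ⊤) (𝕜 := ℂ) ν (fourier n)
  filter_upwards [h1, h2] with θ h3 h4
  rw [ContinuousLinearMap.mul_apply', h4] at h3
  exact h3

theorem fourierMul_zero (f : LTwo ν) : fourierMul ν 0 f = f := by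
  apply Lp.ext
  filter_upwards [coeFn_fourierMul ν 0 f] with θ h
  rw [h, fourier_zero, one_mul]

theorem fourierMul_fourierMul (m n : ℤ) (f : LTwo ν) :
    fourierMul ν m (fourierMul ν n f) = fourierMul ν (m + n) f := by
  apply Lp.ext
  filter_upwards [coeFn_fourierMul ν m (fourierMul ν n f), coeFn_fourierMul ν n f,
    coeFn_fourierMul ν (m + n) f] with θ h1 h2 h3
  rw [h1, h2, h3, fourier_add, mul_assoc]

theorem inner_fourierMul_eq_integral (n : ℤ) (f g : LTwo ν) :
    inner ℂ (fourierMul ν n f) g = ∫ θ, fourier (-n) θ * (conj (f θ) * g θ) ∂ν := by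
  rw [L2.inner_def]
  apply integral_congr_ae
  filter_upwards [coeFn_fourierMul ν n f] with θ h
  rw [h, fourier_neg]
  simp
  ring

theorem inner_fourierMul_left (n : ℤ) (f g : LTwo ν) :
    inner ℂ (fourierMul ν n f) g = inner ℂ f (fourierMul ν (-n) g) := by
  rw [inner_fourierMul_eq_integral, L2.inner_def]
  apply integral_congr_ae
  filter_upwards [coeFn_fourierMul ν (-n) g] with θ h
  rw [h]
  simp
  ring

theorem inner_fourierMul_fourierMul (n : ℤ) (f g : LTwo ν) :
    inner ℂ (fourierMul ν n f) (fourierMul ν n g) = inner ℂ f g := by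
  rw [inner_fourierMul_left, fourierMul_fourierMul, neg_add_cancel, fourierMul_zero]

theorem fourierMul_toLp (n : ℤ) (f : C(AddCircle (2 * Real.pi), ℂ)) :
    fourierMul ν n (ContinuousMap.toLp (E := ℂ) 2 ν ℂ f) =
      ContinuousMap.toLp (E := ℂ) 2 ν ℂ (fourier n * f) := by
  apply Lp.ext
  filter_upwards [coeFn_fourierMul ν n (ContinuousMap.toLp (E := ℂ) 2 ν ℂ f),
    ContinuousMap.coeFn_toLp (E := ℂ) (p := 2) (𝕜 := ℂ) ν f,
    ContinuousMap.coeFn_toLp (E := ℂ) (p := 2) (𝕜 := ℂ) ν (fourier n * f)] with θ h1 h2 h3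
  rw [h1, h2, h3]
  rfl

theorem polyOnCircle_X_pow (n : ℕ) : polyOnCircle (Polynomial.X ^ n) = fourier (n : ℤ) := by
  ext θ
  simp [polyOnCircle, fourier_apply, AddCircle.toCircle_nsmul]

theorem polyLTwo_X_mul (p : Polynomial ℂ) :
    polyLTwo ν (Polynomial.X * p) = fourierMul ν 1 (polyLTwo ν p) := by
  rw [polyLTwo, polyLTwo, fourierMul_toLp]
  congr 1
  ext θ
  simp [polyOnCircle]

theorem fourierMul_one_mem_HTwo {f : LTwo ν} (hf : f ∈ HTwo ν) : fourierMul ν 1 f ∈ HTwo ν := by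
  have h : Submodule.span ℂ (Set.range fun m : ℕ => polyLTwo ν (Polynomial.X ^ m)) ≤
      (HTwo ν).comap (fourierMul ν 1).toLinearMap := by
    rw [Submodule.span_le]
    rintro _ ⟨m, rfl⟩
    simp only [SetLike.mem_coe, Submodule.mem_comap, ContinuousLinearMap.coe_coe]
    rw [← polyLTwo_X_mul]
    exact polyLTwo_mem_HTwo ν _
  have hc : IsClosed ((HTwo ν).comap (fourierMul ν 1).toLinearMap : Set (LTwo ν)) :=
    (Submodule.isClosed_topologicalClosure _).preimage (fourierMul ν 1).continuous
  exact Submodule.topologicalClosure_minimal _ h hc hf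

theorem eq_zero_of_inner_polyHTwo_eq_zero {f : HTwo ν}
    (hf : ∀ p : Polynomial ℂ, inner ℂ f (polyHTwo ν p) = 0) : f = 0 := by
  have h : Submodule.span ℂ (Set.range fun m : ℕ => polyLTwo ν (Polynomial.X ^ m)) ≤
      (ℂ ∙ (f : LTwo ν))ᗮ := by
    rw [Submodule.span_le]
    rintro _ ⟨m, rfl⟩
    exact Submodule.mem_orthogonal_singleton_iff_inner_right.2 (hf (Polynomial.X ^ m))
  have hm := Submodule.topologicalClosure_minimal _ h (Submodule.isClosed_orthogonal _) f.2
  rw [Submodule.mem_orthogonal_singleton_iff_inner_right, inner_self_eq_zero] at hm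
  exact Subtype.ext hm

/-- The operator of multiplication by `z` on `H₂(dν)`. -/
def shiftHTwo : HTwo ν →L[ℂ] HTwo ν :=
  ((fourierMul ν 1).comp (HTwo ν).subtypeL).codRestrict (HTwo ν)
    fun f => fourierMul_one_mem_HTwo ν f.2

theorem coe_shiftHTwo_pow (n : ℕ) (f : HTwo ν) :
    ((shiftHTwo ν ^ n) f : LTwo ν) = fourierMul ν n f := by
  induction n with
  | zero => simp [fourierMul_zero]
  | succ n ih =>
    rw [pow_succ', Nat.cast_succ, add_comm, ← fourierMul_fourierMul, ← ih]
    rfl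

theorem shiftHTwo_polyHTwo (p : Polynomial ℂ) :
    shiftHTwo ν (polyHTwo ν p) = polyHTwo ν (Polynomial.X * p) :=
  Subtype.ext (polyLTwo_X_mul ν p).symm

theorem inner_shiftHTwo_shiftHTwo (f g : HTwo ν) :
    inner ℂ (shiftHTwo ν f) (shiftHTwo ν g) = inner ℂ f g :=
  inner_fourierMul_fourierMul ν 1 f g

/-- If multiplication by `z` maps `H₂(dν)` onto itself, then `H₂(dν) = L²(dν)`. -/
theorem HTwo_eq_top_of_surjective (h : Function.Surjective (shiftHTwo ν)) : HTwo ν = ⊤ := by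
  -- Surjectivity allows division by `z` inside `H₂(dν)`.
  have hneg : ∀ n : ℕ, ∀ f ∈ HTwo ν, fourierMul ν (-n) f ∈ HTwo ν := by
    intro n
    induction n with
    | zero => intro f hf; simpa [fourierMul_zero] using hf
    | succ n ih =>
      intro f hf
      obtain ⟨g, hg⟩ := h ⟨f, hf⟩
      have hg' : fourierMul ν 1 g = f := congrArg Subtype.val hg
      rw [← hg', fourierMul_fourierMul]
      convert ih g g.2 using 2
      push_cast
      ring_nf
  have hmem : ∀ n : ℤ, ContinuousMap.toLp (E := ℂ) 2 ν ℂ (fourier n) ∈ HTwo ν := by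
    intro n
    obtain ⟨m, rfl | rfl⟩ := n.eq_nat_or_neg
    · rw [← polyOnCircle_X_pow]
      exact polyLTwo_mem_HTwo ν _
    · have h1 := hneg m _ (polyLTwo_mem_HTwo ν 1)
      rw [polyLTwo, fourierMul_toLp] at h1
      convert h1 using 2
      ext θ
      simp [polyOnCircle]
  have hd := (ContinuousMap.toLp_denseRange ℂ ν ℂ
    (ENNReal.ofNat_ne_top (n := 2))).topologicalClosure_map_submodule
      (span_fourier_closure_eq_top (T := 2 * Real.pi))
  rw [eq_top_iff, ← hd]
  refine Submodule.topologicalClosure_minimal _ ?_ (Submodule.isClosed_topologicalClosure _)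
  rw [Submodule.map_span, Submodule.span_le]
  rintro _ ⟨_, ⟨n, rfl⟩, rfl⟩
  exact hmem n

/-- If `H₂(dν) ≠ L²(dν)`, there is a unit vector in `H₂(dν)` orthogonal to `z H₂(dν)`. -/
theorem exists_wandering_vector (hν : HTwo ν ≠ ⊤) :
    ∃ e : HTwo ν, ‖e‖ = 1 ∧ ∀ f, inner ℂ e (shiftHTwo ν f) = 0 :=
  exists_unit_vector_orthogonal_range (inner_shiftHTwo_shiftHTwo ν)
    fun h => hν (HTwo_eq_top_of_surjective ν h)

end FourierMul

/-! ### Fourier uniqueness for measures and for `L²` functions. -/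

section Uniqueness

/-- A finite measure on the circle is determined by its Fourier coefficients. -/
theorem measure_ext_of_integral_fourier {T : ℝ} [Fact (0 < T)] {μ₁ μ₂ : Measure (AddCircle T)}
    [IsFiniteMeasure μ₁] [IsFiniteMeasure μ₂]
    (h : ∀ n : ℤ, ∫ θ, fourier n θ ∂μ₁ = ∫ θ, fourier n θ ∂μ₂) : μ₁ = μ₂ := by
  -- Integration written as pairing with `1`, so that its continuity comes for free.
  let Λ (μ : Measure (AddCircle T)) [IsFiniteMeasure μ] : C(AddCircle T, ℂ) →L[ℂ] ℂ :=
    (innerSL ℂ (ContinuousMap.toLp (E := ℂ) 2 μ ℂ 1)).comp (ContinuousMap.toLp (E := ℂ) 2 μ ℂ)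
  have hΛ (μ : Measure (AddCircle T)) [IsFiniteMeasure μ] (f : C(AddCircle T, ℂ)) :
      Λ μ f = ∫ θ, f θ ∂μ := by
    refine (ContinuousMap.inner_toLp μ 1 f).trans ?_
    simp
  have hdense : Dense (Submodule.span ℂ (Set.range (@fourier T)) : Set C(AddCircle T, ℂ)) :=
    Submodule.dense_iff_topologicalClosure_eq_top.2 span_fourier_closure_eq_top
  have hEq : Λ μ₁ = Λ μ₂ := by
    refine ContinuousLinearMap.ext_on hdense ?_
    rintro _ ⟨n, rfl⟩
    rw [hΛ, hΛ, h]
  refine ext_of_forall_integral_eq_of_IsFiniteMeasure fun f => ?_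
  have hf := congrArg (fun L => L ⟨fun θ => (f θ : ℂ), by fun_prop⟩) hEq
  simp only [hΛ, ContinuousMap.coe_mk] at hf
  rw [integral_complex_ofReal, integral_complex_ofReal] at hf
  exact_mod_cast hf

variable {ν : Measure (AddCircle (2 * Real.pi))} [IsFiniteMeasure ν]

theorem integral_fourier_haarAddCircle {T : ℝ} [Fact (0 < T)] (n : ℤ) :
    ∫ θ : AddCircle T, fourier n θ ∂AddCircle.haarAddCircle = if n = 0 then 1 else 0 := by
  have h := orthonormal_iff_ite.1 (orthonormal_fourier (T := T)) 0 n
  rw [ContinuousMap.inner_toLp AddCircle.haarAddCircle] at h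
  simpa [eq_comm] using h

/-- If all Fourier coefficients of `|e|² dν` but the zeroth vanish, then `|e|² dν` is the normalised
Lebesgue measure, for a unit vector `e`. -/
theorem withDensity_nnnorm_sq_eq {e : LTwo ν} (he : ‖e‖ = 1)
    (h : ∀ n : ℤ, n ≠ 0 → inner ℂ (fourierMul ν n e) e = 0) :
    ν.withDensity (fun θ => ((‖e θ‖₊ ^ 2 : NNReal) : ENNReal)) = AddCircle.haarAddCircle := by
  have hmeas : Measurable fun θ => (‖e θ‖₊ ^ 2 : NNReal) :=
    (Lp.stronglyMeasurable e).measurable.nnnorm.pow_const 2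
  have hint : Integrable (fun θ => ‖e θ‖ ^ 2) ν := (Lp.memLp e).integrable_norm_pow two_ne_zero
  have : IsFiniteMeasure (ν.withDensity fun θ => ((‖e θ‖₊ ^ 2 : NNReal) : ENNReal)) := by
    refine isFiniteMeasure_withDensity ?_
    have := hint.hasFiniteIntegral
    rw [HasFiniteIntegral] at this
    refine ne_of_eq_of_ne (lintegral_congr fun θ => ?_) this.ne
    rw [enorm_pow, enorm_norm, ENNReal.coe_pow]
    rfl
  refine measure_ext_of_integral_fourier fun n => ?_
  rw [integral_withDensity_eq_integral_smul hmeas, integral_fourier_haarAddCircle]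
  have h1 : ∫ θ, (‖e θ‖₊ ^ 2 : NNReal) • (fourier n θ : ℂ) ∂ν =
      inner ℂ (fourierMul ν (-n) e) e := by
    rw [inner_fourierMul_eq_integral]
    refine integral_congr_ae (Filter.Eventually.of_forall fun θ => ?_)
    simp only [neg_neg, Complex.conj_mul', NNReal.smul_def]
    simp [mul_comm]
  rw [h1]
  split_ifs with hn
  · subst hn
    rw [neg_zero, fourierMul_zero, inner_self_eq_norm_sq_to_K, he]
    simp
  · exact h _ (by simpa using hn)

/-- Since `|e|² dν` is Lebesgue measure, `f / e` lies in `L²(dθ)`, and its Fourier coefficients are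
the given inner products. Absolute continuity carries `f / e = 0` and `e ≠ 0` back to `ν`-almost
every point. -/
theorem eq_zero_of_inner_fourierMul_eq_zero (hac : ν ≪ volume) {e f : LTwo ν} (he : ‖e‖ = 1)
    (h : ∀ n : ℤ, n ≠ 0 → inner ℂ (fourierMul ν n e) e = 0)
    (hf : ∀ n : ℤ, inner ℂ (fourierMul ν n e) f = 0) : f = 0 := by
  have hw := withDensity_nnnorm_sq_eq he h
  have hme := (Lp.stronglyMeasurable e).measurable
  have hmf := (Lp.stronglyMeasurable f).measurable
  have hmeas : Measurable fun θ => (‖e θ‖₊ ^ 2 : NNReal) := hme.nnnorm.pow_const 2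
  have hac' : ν ≪ AddCircle.haarAddCircle := by
    rw [AddCircle.volume_eq_smul_haarAddCircle] at hac
    exact hac.trans Measure.smul_absolutelyContinuous
  have he0 : ∀ᵐ θ ∂AddCircle.haarAddCircle, e θ ≠ 0 := by
    rw [← hw, ae_withDensity_iff hmeas.coe_nnreal_ennreal]
    refine Filter.Eventually.of_forall fun θ hθ h0 => hθ ?_
    simp [h0]
  have hmg : Measurable fun θ => f θ / e θ := hmf.div hme
  have hg : MemLp (fun θ => f θ / e θ) 2 AddCircle.haarAddCircle := by
    rw [memLp_two_iff_integrable_sq_norm hmg.aestronglyMeasurable, ← hw,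
      integrable_withDensity_iff_integrable_smul hmeas]
    refine ((Lp.memLp f).integrable_norm_pow two_ne_zero).mono' ?_ ?_
    · exact (hmeas.smul (hmg.norm.pow_const 2)).aestronglyMeasurable
    · refine Filter.Eventually.of_forall fun θ => ?_
      -- Where `e` vanishes, `f / e` is `0` by convention and the density is `0` too.
      by_cases h0 : e θ = 0
      · simp [h0]
      · have : ‖e θ‖ ≠ 0 := norm_ne_zero_iff.2 h0
        simp only [NNReal.smul_def, norm_div]
        simp
        field_simp
        rfl
  have hg0 : hg.toLp = 0 := by
    rw [← (fourierBasis (T := 2 * Real.pi)).repr.map_eq_zero_iff]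
    ext n
    rw [fourierBasis_repr, fourierCoeff_congr_ae hg.coeFn_toLp, fourierCoeff, ← hw,
      integral_withDensity_eq_integral_smul hmeas]
    refine Eq.trans ?_ (hf n)
    rw [inner_fourierMul_eq_integral]
    refine integral_congr_ae (Filter.Eventually.of_forall fun θ => ?_)
    by_cases h0 : e θ = 0
    · simp [h0]
    · have h1 : conj (e θ) * f θ = (‖e θ‖ : ℂ) ^ 2 * (f θ / e θ) := by
        rw [← Complex.conj_mul']
        field_simp
      simp only [h1, NNReal.smul_def]
      simp
      ring
  have hg1 : ∀ᵐ θ ∂AddCircle.haarAddCircle, f θ / e θ = 0 := by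
    have h1 := hg.coeFn_toLp
    rw [hg0] at h1
    exact h1.symm.trans (Lp.coeFn_zero _ _ _)
  rw [Lp.eq_zero_iff_ae_eq_zero]
  filter_upwards [hac'.ae_le hg1, hac'.ae_le he0] with θ h1 h2
  simpa [h2] using h1

end Uniqueness

/-! ### Reproducing kernel spaces from total families. -/

section OfReproducingVectors

variable {H X : Type*} [NormedAddCommGroup H] [InnerProductSpace ℂ H]

/-- A Hilbert space with a total family `k` of vectors is a reproducing kernel Hilbert space, the
element `f` being identified with the function `x ↦ ⟪k x, f⟫`. -/
@[reducible]
def RKHS.ofTotal (k : X → H) (hk : ∀ f, (∀ x, inner ℂ (k x) f = 0) → f = 0) : RKHS ℂ H X ℂ where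
  coeCLM := ContinuousLinearMap.pi fun x => innerSL ℂ (k x)
  coeCLM_injective := by
    refine (injective_iff_map_eq_zero _).2 fun f hf => hk f fun x => ?_
    exact congrFun hf x

theorem RKHS.kernel_ofTotal [CompleteSpace H] (k : X → H)
    (hk : ∀ f, (∀ x, inner ℂ (k x) f = 0) → f = 0) (x y : X) :
    letI := RKHS.ofTotal k hk
    RKHS.kernel H x y 1 = inner ℂ (k x) (k y) := by
  let := RKHS.ofTotal k hk
  have h : RKHS.kerFun H y (1 : ℂ) = k y := by
    refine ext_inner_right ℂ fun f => ?_
    rw [RKHS.kerFun_inner]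
    simp
    rfl
  rw [← RKHS.kerFun_apply, h]
  rfl

end OfReproducingVectors

/-! ### The Szegő function and the evaluation vectors. -/

section Szego

variable (ν : Measure (AddCircle (2 * Real.pi))) [IsFiniteMeasure ν]

theorem polyHTwo_add (p q : Polynomial ℂ) :
    polyHTwo ν (p + q) = polyHTwo ν p + polyHTwo ν q := by
  have h : polyOnCircle (p + q) = polyOnCircle p + polyOnCircle q := by
    ext θ; simp [polyOnCircle]
  apply Subtype.ext
  change polyLTwo ν (p + q) = polyLTwo ν p + polyLTwo ν q
  rw [polyLTwo, h, map_add]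
  rfl

theorem polyHTwo_C (a : ℂ) : polyHTwo ν (Polynomial.C a) = a • polyHTwo ν 1 := by
  have h : polyOnCircle (Polynomial.C a) = a • polyOnCircle 1 := by
    ext θ; simp [polyOnCircle]
  apply Subtype.ext
  change polyLTwo ν (Polynomial.C a) = a • polyLTwo ν 1
  rw [polyLTwo, h, map_smul]
  rfl

theorem inner_smul_left_HTwo (a : ℂ) (f g : HTwo ν) :
    inner ℂ (a • f) g = conj a * inner ℂ f g :=
  inner_smul_left f g a

theorem inner_smul_right_HTwo (a : ℂ) (f g : HTwo ν) :
    inner ℂ f (a • g) = a * inner ℂ f g :=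
  inner_smul_right f g a

theorem opNorm_shiftHTwo_le_one : ‖shiftHTwo ν‖ ≤ 1 :=
  opNorm_le_one_of_inner_map_map (inner_shiftHTwo_shiftHTwo ν)

variable {ν}
variable {e : HTwo ν}

/-- The function `w ↦ ⟪(1 - w* z)⁻¹ e, 1⟫`, the reciprocal of the Szegő function of `ν` in the
disc. -/
def szegoRecip (e : HTwo ν) (w : ℂ) : ℂ :=
  inner ℂ (cauchyVector (shiftHTwo ν) e w) (polyHTwo ν 1)

theorem inner_cauchyVector_polyHTwo (he : ∀ f, inner ℂ e (shiftHTwo ν f) = 0) {w : ℂ}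
    (hw : ‖w‖ < 1) (p : Polynomial ℂ) :
    inner ℂ (cauchyVector (shiftHTwo ν) e w) (polyHTwo ν p) = p.eval w * szegoRecip e w := by
  induction p using Polynomial.induction_on with
  | C a => simp [polyHTwo_C, szegoRecip]
  | add p q hp hq => rw [polyHTwo_add, inner_add_right, hp, hq, Polynomial.eval_add, add_mul]
  | monomial n a h =>
    have h1 : Polynomial.C a * Polynomial.X ^ (n + 1) =
        Polynomial.X * (Polynomial.C a * Polynomial.X ^ n) := by ring
    rw [h1, ← shiftHTwo_polyHTwo, inner_cauchyVector_map (inner_shiftHTwo_shiftHTwo ν) he hw, h,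
      Polynomial.eval_mul (p := Polynomial.X), Polynomial.eval_X, mul_assoc]

/-- Otherwise `c_w` would be orthogonal to all polynomials, which are dense, although `c_w ≠ 0`. -/
theorem szegoRecip_ne_zero (he : ∀ f, inner ℂ e (shiftHTwo ν f) = 0) (he0 : e ≠ 0) {w : ℂ}
    (hw : ‖w‖ < 1) : szegoRecip e w ≠ 0 := by
  intro h
  refine cauchyVector_ne_zero (opNorm_shiftHTwo_le_one ν) hw he0
    (eq_zero_of_inner_polyHTwo_eq_zero ν fun p => ?_)
  rw [inner_cauchyVector_polyHTwo he hw, h, mul_zero]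

/-- The vector representing the evaluation of polynomials at `w`. -/
def evalVector (e : HTwo ν) (w : ℂ) : HTwo ν :=
  conj (szegoRecip e w)⁻¹ • cauchyVector (shiftHTwo ν) e w

theorem inner_evalVector_polyHTwo (he : ∀ f, inner ℂ e (shiftHTwo ν f) = 0) (he0 : e ≠ 0) {w : ℂ}
    (hw : ‖w‖ < 1) (p : Polynomial ℂ) :
    inner ℂ (evalVector e w) (polyHTwo ν p) = p.eval w := by
  rw [evalVector, inner_smul_left_HTwo, inner_cauchyVector_polyHTwo he hw, Complex.conj_conj]
  field_simp [szegoRecip_ne_zero he he0 hw]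

/-- The Szegő function of `ν` in the disc, continued to the exterior of the disc by the reflection
`A(z) A(1 / z*)* = 1`. -/
def szegoFunction (e : HTwo ν) (z : ℂ) : ℂ :=
  if ‖z‖ < 1 then (szegoRecip e z)⁻¹ else conj (szegoRecip e (conj z)⁻¹)

theorem analyticOnNhd_szegoFunction (he : ∀ f, inner ℂ e (shiftHTwo ν f) = 0) (he0 : e ≠ 0) :
    AnalyticOnNhd ℂ (szegoFunction e) {z : ℂ | ‖z‖ ≠ 1} := by
  intro w hw
  rcases lt_or_gt_of_ne hw with hw | hw
  · have h1 : AnalyticAt ℂ (fun z => (szegoRecip e z)⁻¹) w :=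
      (analyticAt_inner_cauchyVector (opNorm_shiftHTwo_le_one ν) _ hw).fun_inv
        (szegoRecip_ne_zero he he0 hw)
    refine h1.congr ?_
    filter_upwards [(isOpen_lt continuous_norm continuous_const).mem_nhds hw] with z hz
    exact (if_pos hz).symm
  · have hw0 : w ≠ 0 := norm_pos_iff.1 (one_pos.trans hw)
    have hwi : ‖w⁻¹‖ < 1 := by rw [norm_inv]; exact inv_lt_one_of_one_lt₀ hw
    -- The outer conjugation swaps the entries of the inner product, and the two conjugates on `z`
    -- cancel.
    have h1 : AnalyticAt ℂ (fun z => inner ℂ (polyHTwo ν 1)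
        ((Ring.inverse (1 - z⁻¹ • shiftHTwo ν) : HTwo ν →L[ℂ] HTwo ν) e)) w :=
      ((innerSL ℂ (polyHTwo ν 1)).analyticAt _).comp
        ((analyticAt_inverse_one_sub_smul (opNorm_shiftHTwo_le_one ν) e hwi).fun_comp
          (analyticAt_inv hw0))
    refine h1.congr ?_
    filter_upwards [(isOpen_lt continuous_const continuous_norm).mem_nhds hw] with z hz
    rw [szegoFunction, if_neg (not_lt.2 (le_of_lt hz)), szegoRecip, cauchyVector, map_inv₀,
      Complex.conj_conj]
    exact (inner_conj_symm (𝕜 := ℂ) (polyHTwo ν 1) _).symm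

/-- The reproducing kernel is `A(z) A(w)* / (1 - z w*)` with the Szegő function `A`: as `|e|² dν` is
Lebesgue measure, the second term of the difference kernel vanishes. -/
theorem inner_evalVector_evalVector (he : ∀ f, inner ℂ e (shiftHTwo ν f) = 0) (he1 : ‖e‖ = 1)
    {z w : ℂ} (hz : ‖z‖ < 1) (hw : ‖w‖ < 1) :
    inner ℂ (evalVector e z) (evalVector e w) = differenceKernel (szegoFunction e) 0 z w := by
  rw [evalVector, evalVector, inner_smul_left_HTwo, inner_smul_right_HTwo,
    inner_cauchyVector_cauchyVector (inner_shiftHTwo_shiftHTwo ν) he he1 hz hw, differenceKernel,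
    szegoFunction, szegoFunction, if_pos hz, if_pos hw]
  simp
  ring

theorem eq_zero_of_inner_evalVector_eq_zero (hac : ν ≪ volume)
    (he : ∀ f, inner ℂ e (shiftHTwo ν f) = 0) (he1 : ‖e‖ = 1) {f : HTwo ν}
    (hf : ∀ w : ℂ, ‖w‖ < 1 → inner ℂ (evalVector e w) f = 0) : f = 0 := by
  have he0 : e ≠ 0 := by rintro rfl; simp at he1
  have hcauchy : ∀ w : ℂ, ‖w‖ < 1 → inner ℂ (cauchyVector (shiftHTwo ν) e w) f = 0 := by
    intro w hw
    have h := hf w hw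
    rw [evalVector, inner_smul_left_HTwo, Complex.conj_conj] at h
    exact (mul_eq_zero.1 h).resolve_left (inv_ne_zero (szegoRecip_ne_zero he he0 hw))
  have hpow : ∀ n : ℕ, inner ℂ (fourierMul ν n e) (f : LTwo ν) = 0 := by
    intro n
    rw [← coe_shiftHTwo_pow]
    exact inner_pow_eq_zero_of_inner_cauchyVector_eq_zero (opNorm_shiftHTwo_le_one ν) n f hcauchy
  -- Moving `z⁻ⁿ` across turns this into `e ⊥ zⁿ g`.
  have hneg : ∀ (n : ℕ) (g : HTwo ν), n ≠ 0 →
      inner ℂ (fourierMul ν (-n) e) (g : LTwo ν) = 0 := by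
    intro n g hn
    obtain ⟨m, rfl⟩ := Nat.exists_eq_succ_of_ne_zero hn
    rw [inner_fourierMul_left, neg_neg, ← coe_shiftHTwo_pow, pow_succ']
    exact he _
  have hee : ∀ n : ℤ, n ≠ 0 → inner ℂ (fourierMul ν n e) (e : LTwo ν) = 0 := by
    intro n hn
    obtain ⟨m, rfl | rfl⟩ := n.eq_nat_or_neg
    · rw [inner_fourierMul_left, ← inner_conj_symm, hneg m e (by simpa using hn), map_zero]
    · exact hneg m e (by simpa using hn)
  refine Subtype.ext (eq_zero_of_inner_fourierMul_eq_zero hac he1 hee fun n => ?_)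
  obtain ⟨m, rfl | rfl⟩ := n.eq_nat_or_neg
  · exact hpow m
  · rcases eq_or_ne m 0 with rfl | hm
    · simpa using hpow 0
    · exact hneg m f hm

end Szego

end

theorem mainTheorem11 (ν : Measure (AddCircle (2 * Real.pi))) [IsFiniteMeasure ν]
    (hν : HTwo ν ≠ ⊤) :
    ∃ (k : Metric.ball (0 : ℂ) 1 → HTwo ν) (A B : ℂ → ℂ),
      IsReproducingFamily ν k ∧
      AnalyticOnNhd ℂ A {z : ℂ | ‖z‖ ≠ 1} ∧
      AnalyticOnNhd ℂ B {z : ℂ | ‖z‖ ≠ 1} ∧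
      (∀ z w : Metric.ball (0 : ℂ) 1, inner ℂ (k z) (k w) = differenceKernel A B z w) ∧
      (ν ≪ volume →
        ∃ _ : RKHS ℂ (HTwo ν) (Metric.ball (0 : ℂ) 1) ℂ,
          (∀ (p : Polynomial ℂ) (w : Metric.ball (0 : ℂ) 1),
            (polyHTwo ν p : Metric.ball (0 : ℂ) 1 → ℂ) w = p.eval (w : ℂ)) ∧
          ∀ z w : Metric.ball (0 : ℂ) 1,
            RKHS.kernel (HTwo ν) z w 1 = differenceKernel A B z w) := by
  obtain ⟨e, he1, he⟩ := exists_wandering_vector ν hν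
  have he0 : e ≠ 0 := by rintro rfl; simp at he1
  have hball : ∀ w : Metric.ball (0 : ℂ) 1, ‖(w : ℂ)‖ < 1 := fun w => mem_ball_zero_iff.1 w.2
  have hrep : IsReproducingFamily ν fun w => evalVector e w :=
    fun w p => inner_evalVector_polyHTwo he he0 (hball w) p
  refine ⟨fun w => evalVector e w, szegoFunction e, 0, hrep, analyticOnNhd_szegoFunction he he0,
    analyticOnNhd_const, fun z w => inner_evalVector_evalVector he he1 (hball z) (hball w),
    fun hac => ?_⟩
  have htotal : ∀ f : HTwo ν,
      (∀ w : Metric.ball (0 : ℂ) 1, inner ℂ (evalVector e (w : ℂ)) f = 0) → f = 0 :=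
    fun f hf => eq_zero_of_inner_evalVector_eq_zero hac he he1
      fun w hw => hf ⟨w, mem_ball_zero_iff.2 hw⟩
  refine ⟨RKHS.ofTotal _ htotal, fun p w => hrep w p, fun z w => ?_⟩
  exact (RKHS.kernel_ofTotal _ htotal z w).trans
    (inner_evalVector_evalVector he he1 (hball z) (hball w))
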